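/- Let $A:[0,1]^2\to\mathbb{R}$ be continuous and let $\beta\in\mathbb{R}$ (in particular, any $\beta>0$). On $C([0,1])$, the Banach space of continuous functions on $[0,1]$ with the sup norm, consider the bounded operators $$\mathcal{L}_\beta\varphi(y)=\int_0^1 e^{\beta A(x,y)}\varphi(x)\,dx,\qquad \bar{\mathcal{L}}_\beta\varphi(x)=\int_0^1 e^{\beta A(x,y)}\varphi(y)\,dy .$$ Then there is a real number $\lambda_\beta>0$, the same for both operators, such that for $T=\mathcal{L}_\beta$ and for $T=\bar{\mathcal{L}}_\beta$, acting on real-valued as well as on complex-valued continuous functions: (i) $\lambda_\beta$ is an eigenvalue of $T$, and it is maximal: $|\mu|<\lambda_\beta$ for every $\mu\neq\lambda_\beta$ in the spectrum of $T$; (ii) $\lambda_\beta$ is simple: its eigenspace is one-dimensional; (iii) $\lambda_\beta$ is isolated: it is not an accumulation point of the spectrum of $T$; (iv) the associated eigenfunctions are positive: there is a continuous $\varphi_\beta$ (depending on $T$) with $\varphi_\beta(x)>0$ for all $x\in[0,1]$ such that the eigenfunctions of $T$ for $\lambda_\beta$ are exactly the nonzero scalar multiples of $\varphi_\beta$. 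-/

import Mathlib

open MeasureTheory Filter Topology unitInterval

noncomputable section

/-- For a continuous kernel `k` on the unit square, the integral operator on `C([0,1], 𝕜)`
(`𝕜 = ℝ` or `ℂ`, sup norm, Lebesgue measure on `[0,1]`)
`(T φ)(y) = ∫ k(x, y) φ(x) dx`. -/
def kernelOp (𝕜 : Type*) [RCLike 𝕜] (k : C(I × I, ℝ)) : C(I, 𝕜) →L[𝕜] C(I, 𝕜) :=
  LinearMap.mkContinuous
    { toFun := fun φ =>
        { toFun := fun y => ∫ x : I, (k (x, y) : 𝕜) * φ x
          continuous_toFun := by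
            refine continuous_parametric_integral_of_continuous (μ := (volume : Measure I))
              (f := fun (y x : I) => (k (x, y) : 𝕜) * φ x) ?_ isCompact_univ |>.congr ?_
            · simp only [Function.uncurry_def]
              fun_prop
            · intro y
              simp }
      map_add' := fun φ ψ => by
        ext y
        simp only [ContinuousMap.coe_mk, ContinuousMap.add_apply, mul_add]
        refine integral_add ?_ ?_
        all_goals
          refine Continuous.integrable_of_hasCompactSupport ?_ (HasCompactSupport.of_compactSpace _)
          fun_prop
      map_smul' := fun c φ => by
        ext y
        simp only [ContinuousMap.coe_mk, ContinuousMap.smul_apply, smul_eq_mul, RingHom.id_apply]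
        rw [← integral_const_mul]
        congr 1
        ext x
        ring }
    ‖k‖ (fun φ => by
      refine (ContinuousMap.norm_le _ (by positivity)).2 fun y => ?_
      have h : ∀ᵐ x : I, ‖(k (x, y) : 𝕜) * φ x‖ ≤ ‖k‖ * ‖φ‖ :=
        Eventually.of_forall fun x => by
          rw [norm_mul, RCLike.norm_ofReal]
          exact mul_le_mul (k.norm_coe_le_norm (x, y)) (φ.norm_coe_le_norm x)
            (norm_nonneg _) (norm_nonneg _)
      simpa using norm_integral_le_of_norm_le_const h)

/-- The Gibbs kernel `(x, y) ↦ exp (β A(x, y))`. -/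
def gibbsKernel (A : C(I × I, ℝ)) (β : ℝ) : C(I × I, ℝ) where
  toFun p := Real.exp (β * A p)

/-- `(𝓛_β φ)(y) = ∫ exp (β A(x, y)) φ(x) dx`. -/
def perronOp (𝕜 : Type*) [RCLike 𝕜] (A : C(I × I, ℝ)) (β : ℝ) : C(I, 𝕜) →L[𝕜] C(I, 𝕜) :=
  kernelOp 𝕜 (gibbsKernel A β)

/-- `(𝓛̄_β φ)(x) = ∫ exp (β A(x, y)) φ(y) dy`. -/
def perronOpBar (𝕜 : Type*) [RCLike 𝕜] (A : C(I × I, ℝ)) (β : ℝ) : C(I, 𝕜) →L[𝕜] C(I, 𝕜) :=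
  kernelOp 𝕜 ((gibbsKernel A β).comp ContinuousMap.prodSwap)

theorem perronOp_apply (𝕜 : Type*) [RCLike 𝕜] (A : C(I × I, ℝ)) (β : ℝ) (φ : C(I, 𝕜)) (y : I) :
    perronOp 𝕜 A β φ y = ∫ x : I, ((Real.exp (β * A (x, y)) : ℝ) : 𝕜) * φ x := rfl

theorem perronOpBar_apply (𝕜 : Type*) [RCLike 𝕜] (A : C(I × I, ℝ)) (β : ℝ) (φ : C(I, 𝕜))
    (x : I) :
    perronOpBar 𝕜 A β φ x = ∫ y : I, ((Real.exp (β * A (x, y)) : ℝ) : 𝕜) * φ y := rfl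

section Spectral

variable {𝕜 : Type*} [RCLike 𝕜]

/-- `r` is an eigenvalue of `T`, and it is maximal: `|μ| < r` for every other point `μ` of the
spectrum. -/
def IsMaximalEigenvalue (T : C(I, 𝕜) →L[𝕜] C(I, 𝕜)) (r : ℝ) : Prop :=
  Module.End.HasEigenvalue (T : C(I, 𝕜) →ₗ[𝕜] C(I, 𝕜)) (r : 𝕜) ∧
    ∀ μ ∈ spectrum 𝕜 T, μ ≠ (r : 𝕜) → ‖μ‖ < r

/-- The eigenspace of `T` for `r` is one-dimensional. -/
def IsSimpleEigenvalue (T : C(I, 𝕜) →L[𝕜] C(I, 𝕜)) (r : ℝ) : Prop :=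
  Module.finrank 𝕜 (Module.End.eigenspace (T : C(I, 𝕜) →ₗ[𝕜] C(I, 𝕜)) (r : 𝕜)) = 1

/-- `r` belongs to the spectrum of `T` and is not an accumulation point of it. -/
def IsIsolatedInSpectrum (T : C(I, 𝕜) →L[𝕜] C(I, 𝕜)) (r : ℝ) : Prop :=
  (r : 𝕜) ∈ spectrum 𝕜 T ∧ ¬ AccPt (r : 𝕜) (𝓟 (spectrum 𝕜 T))

/-- There is a strictly positive function whose nonzero scalar multiples are exactly the
eigenfunctions of `T` for `r`. -/
def HasPositiveEigenfunctions (T : C(I, 𝕜) →L[𝕜] C(I, 𝕜)) (r : ℝ) : Prop :=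
  ∃ φ : C(I, ℝ), (∀ x, 0 < φ x) ∧
    ∀ ψ : C(I, 𝕜), Module.End.HasEigenvector (T : C(I, 𝕜) →ₗ[𝕜] C(I, 𝕜)) (r : 𝕜) ψ ↔
      ∃ c : 𝕜, c ≠ 0 ∧ ∀ x, ψ x = c * (φ x : 𝕜)

/-- All the spectral properties together. -/
def IsPrincipalEigenvalue (T : C(I, 𝕜) →L[𝕜] C(I, 𝕜)) (r : ℝ) : Prop :=
  IsMaximalEigenvalue T r ∧ IsSimpleEigenvalue T r ∧ IsIsolatedInSpectrum T r ∧
    HasPositiveEigenfunctions T r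

end Spectral

end

/-! This is a Perron–Frobenius argument for a compact operator `T` with strictly positive continuous
kernel. A Collatz–Wielandt supremum gives positive eigenfunctions `φ` of `T` and `θ` of its
transpose (`exists_pos_eigenfunction_kernelOp`); pairing them forces a common eigenvalue `r`
(`eigenvalue_eq_of_transpose`).

The rest follows from a spectral gap (`norm_eigenvalue_le_of_integral_eq_zero`). For small `ε > 0`
the kernel `k(x,y) - ε θ(x) φ(y)` is still nonnegative and acts like `k` on functions `ψ` with `∫ θψ
= 0`. Taking absolute values and integrating against `θ` bounds every eigenvalue on that hyperplane
by `r - ε ∫ θφ`. Eigenfunctions for `μ ≠ r` lie in it by duality, and an eigenfunction for `r` falls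
into it after subtracting a multiple of `φ`, hence was that multiple. By compactness, nonzero
spectral points are eigenvalues, so the gap holds for the whole spectrum. -/

instance unitInterval.isOpenPosMeasure_volume : (volume : Measure I).IsOpenPosMeasure where
  open_pos := by
    rintro U ⟨V, hV, rfl⟩ ⟨x, hx⟩
    have hcl : (x : ℝ) ∈ closure (Set.Ioo (0 : ℝ) 1) := by
      rw [closure_Ioo zero_ne_one]
      exact x.2
    obtain ⟨z, hz⟩ := mem_closure_iff.1 hcl V hV hx
    have hpos : 0 < volume (V ∩ Set.Ioo (0 : ℝ) 1) :=
      (hV.inter isOpen_Ioo).measure_pos volume ⟨z, hz⟩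
    rw [unitInterval.volume_apply]
    refine (hpos.trans_le (measure_mono ?_)).ne'
    rintro w ⟨hwV, hw⟩
    exact ⟨⟨w, hw.1.le, hw.2.le⟩, hwV, rfl⟩

theorem Continuous.integrable_unitInterval {E : Type*} [NormedAddCommGroup E]
    {f : I → E} (hf : Continuous f) : Integrable f :=
  hf.integrable_of_hasCompactSupport (HasCompactSupport.of_compactSpace _)

theorem ContinuousMap.integral_pos_of_nonneg_of_ne_zero {f : C(I, ℝ)} (hf : ∀ x, 0 ≤ f x)
    (h : f ≠ 0) : 0 < ∫ x, f x := by
  obtain ⟨x, hx⟩ := DFunLike.ne_iff.1 h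
  exact f.continuous.integral_pos_of_hasCompactSupport_nonneg_nonzero
    (HasCompactSupport.of_compactSpace _) hf hx

theorem ContinuousMap.exists_pos_forall_le {X : Type*} [TopologicalSpace X] [CompactSpace X]
    (f : C(X, ℝ)) (hf : ∀ x, 0 < f x) : ∃ m > 0, ∀ x, m ≤ f x := by
  rcases isEmpty_or_nonempty X with h | h
  · exact ⟨1, one_pos, fun x => h.elim x⟩
  · obtain ⟨x, -, hx⟩ := isCompact_univ.exists_isMinOn Set.univ_nonempty f.continuous.continuousOn
    exact ⟨f x, hf x, fun y => hx (Set.mem_univ y)⟩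

/-! ### Compactness, positivity and duality of integral operators -/

section Kernel

variable {𝕜 : Type*} [RCLike 𝕜]

theorem kernelOp_apply (k : C(I × I, ℝ)) (φ : C(I, 𝕜)) (y : I) :
    kernelOp 𝕜 k φ y = ∫ x : I, (k (x, y) : 𝕜) * φ x := rfl

/-- Supplies a modulus of continuity uniform over the unit ball, which is the equicontinuity needed
for Arzelà–Ascoli. -/
theorem norm_kernelOp_apply_sub_le (k : C(I × I, ℝ)) (φ : C(I, 𝕜)) (y z : I) :
    ‖kernelOp 𝕜 k φ y - kernelOp 𝕜 k φ z‖ ≤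
      ‖(k.comp ContinuousMap.prodSwap).curry y - (k.comp ContinuousMap.prodSwap).curry z‖ *
        ‖φ‖ := by
  rw [kernelOp_apply, kernelOp_apply, ← integral_sub
    (Continuous.integrable_unitInterval (by fun_prop))
    (Continuous.integrable_unitInterval (by fun_prop))]
  refine (norm_integral_le_of_norm_le_const (C := ‖(k.comp ContinuousMap.prodSwap).curry y -
    (k.comp ContinuousMap.prodSwap).curry z‖ * ‖φ‖) (Eventually.of_forall fun x => ?_)).trans_eq
    (by simp)
  rw [← sub_mul, norm_mul, ← RCLike.ofReal_sub, RCLike.norm_ofReal]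
  refine mul_le_mul ?_ (φ.norm_coe_le_norm x) (norm_nonneg _) (norm_nonneg _)
  exact ((k.comp ContinuousMap.prodSwap).curry y -
    (k.comp ContinuousMap.prodSwap).curry z).norm_coe_le_norm x

theorem isCompactOperator_kernelOp (k : C(I × I, ℝ)) : IsCompactOperator (kernelOp 𝕜 k) := by
  let e := ContinuousMap.isometryEquivBoundedOfCompact I 𝕜
  let S : Set (BoundedContinuousFunction I 𝕜) :=
    e '' (kernelOp 𝕜 k '' Metric.closedBall 0 1)
  have hS : IsCompact (closure S) := by
    refine BoundedContinuousFunction.arzela_ascoli (Metric.closedBall (0 : 𝕜) ‖kernelOp 𝕜 k‖)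
      (isCompact_closedBall _ _) S ?_ ?_
    · rintro _ x ⟨_, ⟨φ, hφ, rfl⟩, rfl⟩
      rw [mem_closedBall_zero_iff] at hφ ⊢
      exact ((kernelOp 𝕜 k φ).norm_coe_le_norm x).trans ((kernelOp 𝕜 k).unit_le_opNorm φ hφ)
    · intro y
      refine Metric.equicontinuousAt_of_continuity_modulus
        (fun z => ‖(k.comp ContinuousMap.prodSwap).curry y -
          (k.comp ContinuousMap.prodSwap).curry z‖) ?_ _ (Eventually.of_forall ?_)
      · refine Continuous.tendsto' (by fun_prop) _ _ (by simp)
      · rintro z ⟨_, ⟨_, ⟨φ, hφ, rfl⟩, rfl⟩⟩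
        rw [mem_closedBall_zero_iff] at hφ
        rw [dist_eq_norm]
        exact (norm_kernelOp_apply_sub_le k φ y z).trans
          (mul_le_of_le_one_right (norm_nonneg _) hφ)
  refine (isCompactOperator_iff_image_closedBall_subset_compact
    (kernelOp 𝕜 k : C(I, 𝕜) →ₗ[𝕜] C(I, 𝕜)) one_pos).2
    ⟨e.symm '' closure S, hS.image e.symm.continuous, fun f hf => ?_⟩
  exact ⟨e f, subset_closure ⟨f, hf, rfl⟩, e.symm_apply_apply f⟩

theorem kernelOp_nonneg {k : C(I × I, ℝ)} (hk : ∀ p, 0 ≤ k p) {φ : C(I, ℝ)}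
    (hφ : ∀ x, 0 ≤ φ x) (y : I) : 0 ≤ kernelOp ℝ k φ y :=
  integral_nonneg fun x => mul_nonneg (hk _) (hφ x)

theorem kernelOp_mono {k : C(I × I, ℝ)} (hk : ∀ p, 0 ≤ k p) {φ ψ : C(I, ℝ)}
    (h : ∀ x, φ x ≤ ψ x) (y : I) : kernelOp ℝ k φ y ≤ kernelOp ℝ k ψ y := by
  have := kernelOp_nonneg hk (φ := ψ - φ) (fun x => sub_nonneg.2 (h x)) y
  rwa [map_sub, ContinuousMap.sub_apply, sub_nonneg] at this

theorem kernelOp_pos {k : C(I × I, ℝ)} (hk : ∀ p, 0 < k p) {φ : C(I, ℝ)}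
    (hφ : ∀ x, 0 ≤ φ x) (h : φ ≠ 0) (y : I) : 0 < kernelOp ℝ k φ y := by
  obtain ⟨m, hm, hmk⟩ := k.exists_pos_forall_le hk
  calc 0 < m * ∫ x, φ x := mul_pos hm (ContinuousMap.integral_pos_of_nonneg_of_ne_zero hφ h)
    _ = ∫ x, m * φ x := (integral_const_mul _ _).symm
    _ ≤ kernelOp ℝ k φ y :=
      integral_mono (Continuous.integrable_unitInterval (by fun_prop))
        (Continuous.integrable_unitInterval (f := fun x => k (x, y) * φ x) (by fun_prop))
        fun x => mul_le_mul_of_nonneg_right (hmk _) (hφ x)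

theorem norm_kernelOp_apply_le {k : C(I × I, ℝ)} (hk : ∀ p, 0 ≤ k p) (ψ : C(I, 𝕜)) (y : I) :
    ‖kernelOp 𝕜 k ψ y‖ ≤ kernelOp ℝ k ⟨fun x => ‖ψ x‖, by fun_prop⟩ y := by
  rw [kernelOp_apply]
  refine (norm_integral_le_integral_norm _).trans_eq (integral_congr_ae (ae_of_all _ fun x => ?_))
  simp [abs_of_nonneg (hk _)]

/-- Integral operators with transposed kernels are dual to each other. -/
theorem integral_mul_kernelOp (k : C(I × I, ℝ)) (f g : C(I, 𝕜)) :
    ∫ y, g y * kernelOp 𝕜 k f y =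
      ∫ x, kernelOp 𝕜 (k.comp ContinuousMap.prodSwap) g x * f x := by
  simp only [kernelOp_apply, ← integral_const_mul, ← integral_mul_const]
  rw [integral_integral_swap_of_hasCompactSupport (by fun_prop)
    (HasCompactSupport.of_compactSpace _)]
  refine integral_congr_ae (ae_of_all _ fun x => integral_congr_ae (ae_of_all _ fun y => ?_))
  simp only [ContinuousMap.comp_apply, ContinuousMap.prodSwap_apply]
  ring

/-- Real functions, as `𝕜`-valued functions. -/
noncomputable def ContinuousMap.ofRealRCLike (𝕜 : Type*) [RCLike 𝕜] (φ : C(I, ℝ)) : C(I, 𝕜) :=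
  ⟨fun x => (φ x : 𝕜), by fun_prop⟩

theorem kernelOp_ofRealRCLike (k : C(I × I, ℝ)) (φ : C(I, ℝ)) :
    kernelOp 𝕜 k (φ.ofRealRCLike 𝕜) = (kernelOp ℝ k φ).ofRealRCLike 𝕜 := by
  ext y
  change (∫ x, (k (x, y) : 𝕜) * (φ x : 𝕜)) = ((∫ x, k (x, y) * φ x : ℝ) : 𝕜)
  rw [← integral_ofReal]
  simp

/-! ### Existence of the principal eigenvalue -/

/-- A positive kernel has a positive eigenfunction with positive eigenvalue: the largest `r`
for which `r φ ≤ T φ` has a nonzero nonnegative solution is attained at an eigenfunction. -/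
theorem exists_pos_eigenfunction_kernelOp {k : C(I × I, ℝ)} (hk : ∀ p, 0 < k p) :
    ∃ r : ℝ, 0 < r ∧ ∃ φ : C(I, ℝ), (∀ x, 0 < φ x) ∧ kernelOp ℝ k φ = r • φ := by
  set T := kernelOp ℝ k with hT
  have hk0 : ∀ p, 0 ≤ k p := fun p => (hk p).le
  let S : Set ℝ := {r | ∃ φ : C(I, ℝ), (∀ x, 0 ≤ φ x) ∧ ‖φ‖ = 1 ∧ ∀ x, r * φ x ≤ T φ x}
  have mem_S : ∀ {r : ℝ} {φ : C(I, ℝ)}, (∀ x, 0 ≤ φ x) → φ ≠ 0 → (∀ x, r * φ x ≤ T φ x) →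
      r ∈ S := by
    intro r φ hφ h0 h
    have hn : 0 < ‖φ‖⁻¹ := inv_pos.2 (norm_pos_iff.2 h0)
    refine ⟨‖φ‖⁻¹ • φ, fun x => mul_nonneg hn.le (hφ x), ?_, fun x => ?_⟩
    · rw [norm_smul, norm_inv, norm_norm, inv_mul_cancel₀ (norm_ne_zero_iff.2 h0)]
    · rw [map_smul, ContinuousMap.smul_apply, ContinuousMap.smul_apply, smul_eq_mul, smul_eq_mul,
        mul_left_comm]
      exact mul_le_mul_of_nonneg_left (h x) hn.le
  have le_norm : ∀ {r : ℝ} {φ : C(I, ℝ)}, (∀ x, 0 ≤ φ x) → ‖φ‖ = 1 →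
      (∀ x, r * φ x ≤ T φ x) → r ≤ ‖T φ‖ := by
    intro r φ hφ h1 h
    rcases le_or_gt r 0 with hr | hr
    · exact hr.trans (norm_nonneg _)
    have : ‖r • φ‖ ≤ ‖T φ‖ := by
      refine (ContinuousMap.norm_le _ (norm_nonneg _)).2 fun x => ?_
      rw [ContinuousMap.smul_apply, smul_eq_mul, Real.norm_of_nonneg (mul_nonneg hr.le (hφ x))]
      exact (h x).trans ((le_abs_self _).trans ((T φ).norm_coe_le_norm x))
    rwa [norm_smul, h1, mul_one, Real.norm_of_nonneg hr.le] at this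
  have hbdd : BddAbove S := by
    refine ⟨‖T‖, ?_⟩
    rintro r ⟨φ, hφ, h1, h⟩
    exact (le_norm hφ h1 h).trans (T.unit_le_opNorm φ h1.le)
  obtain ⟨m, hm, hmT⟩ := (T 1).exists_pos_forall_le
    (kernelOp_pos hk (fun _ => zero_le_one) one_ne_zero)
  have hmS : m ∈ S := mem_S (φ := 1) (fun _ => zero_le_one) one_ne_zero fun x => by
    simpa using hmT x
  set r := sSup S
  have hr : 0 < r := hm.trans_le (le_csSup hbdd hmS)
  obtain ⟨u, -, hu, huS⟩ := exists_seq_tendsto_sSup ⟨m, hmS⟩ hbdd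
  choose φ hφ0 hφ1 hφ using huS
  obtain ⟨K, hK, hKT⟩ := IsCompactOperator.image_closedBall_subset_compact
    (f := (T : C(I, ℝ) →ₗ[ℝ] C(I, ℝ))) (isCompactOperator_kernelOp k) 1
  obtain ⟨ψ, -, s, hs, hψ⟩ := hK.tendsto_subseq (x := fun n => T (φ n))
    fun n => hKT ⟨φ n, by simp [hφ1 n], rfl⟩
  have hus : Tendsto (fun n => u (s n)) atTop (𝓝 r) := hu.comp hs.tendsto_atTop
  have eval_tendsto : ∀ x, Tendsto (fun n => T (φ (s n)) x) atTop (𝓝 (ψ x)) := fun x =>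
    ((continuous_eval_const x).tendsto ψ).comp hψ
  have hψ0 : ∀ x, 0 ≤ ψ x := fun x =>
    ge_of_tendsto' (eval_tendsto x) fun n => kernelOp_nonneg hk0 (hφ0 _) x
  have hψne : ψ ≠ 0 := by
    have : r ≤ ‖ψ‖ := le_of_tendsto_of_tendsto' hus hψ.norm
      fun n => le_norm (hφ0 _) (hφ1 _) (hφ _)
    exact norm_pos_iff.1 (hr.trans_le this)
  have hψr : ∀ x, r * ψ x ≤ T ψ x := fun x => by
    refine le_of_tendsto_of_tendsto' (hus.mul (eval_tendsto x))
      (((continuous_eval_const x).tendsto (T ψ)).comp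
        ((T.continuous.tendsto ψ).comp hψ)) fun n => ?_
    -- Only `T (φ (s n))` is known to converge, so `T` is applied to the inequality for `φ (s n)`
    -- before passing to the limit.
    have := kernelOp_mono hk0 (φ := u (s n) • φ (s n)) (ψ := T (φ (s n))) (hφ (s n)) x
    rwa [map_smul] at this
  -- Otherwise `T` makes the nonnegative defect strictly positive, and `T ψ` is a test function
  -- admitting a value larger than the supremum `r`.
  have heig : T ψ - r • ψ = 0 := by
    by_contra hne
    have hT0 : ∀ x, 0 < T (T ψ - r • ψ) x := kernelOp_pos hk (fun x => sub_nonneg.2 (hψr x)) hne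
    have hTψ : ∀ x, 0 < T ψ x := kernelOp_pos hk hψ0 hψne
    obtain ⟨c, hc, hcT⟩ := (T (T ψ - r • ψ)).exists_pos_forall_le hT0
    have hn : 0 < ‖T ψ‖ := (hTψ 0).trans_le ((le_abs_self _).trans ((T ψ).norm_coe_le_norm 0))
    have : r + c / ‖T ψ‖ ∈ S := by
      refine mem_S (φ := T ψ) (fun x => (hTψ x).le) (norm_pos_iff.1 hn) fun x => ?_
      have h1 : c / ‖T ψ‖ * T ψ x ≤ c := by
        rw [div_mul_eq_mul_div]
        exact div_le_of_le_mul₀ hn.le hc.le (mul_le_mul_of_nonneg_left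
          ((le_abs_self _).trans ((T ψ).norm_coe_le_norm x)) hc.le)
      have h2 := hcT x
      rw [map_sub, map_smul, ContinuousMap.sub_apply, ContinuousMap.smul_apply,
        smul_eq_mul] at h2
      linarith
    have := le_csSup hbdd this
    have := div_pos hc hn
    linarith
  rw [sub_eq_zero] at heig
  refine ⟨r, hr, ψ, fun x => ?_, heig⟩
  have := kernelOp_pos hk hψ0 hψne x
  rw [← hT, heig] at this
  exact pos_of_mul_pos_right this hr.le

/-- Positive eigenfunctions of an integral operator and of its transpose belong to the same
eigenvalue. -/
theorem eigenvalue_eq_of_transpose {k : C(I × I, ℝ)} {r s : ℝ} {φ θ : C(I, ℝ)}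
    (hφ : ∀ x, 0 < φ x) (hθ : ∀ x, 0 < θ x) (h : kernelOp ℝ k φ = r • φ)
    (h' : kernelOp ℝ (k.comp ContinuousMap.prodSwap) θ = s • θ) : r = s := by
  have hpos : 0 < ∫ x, (θ * φ) x :=
    ContinuousMap.integral_pos_of_nonneg_of_ne_zero (fun x => (mul_pos (hθ x) (hφ x)).le)
      (DFunLike.ne_iff.2 ⟨0, (mul_pos (hθ 0) (hφ 0)).ne'⟩)
  have := integral_mul_kernelOp k φ θ
  rw [h, h'] at this
  simp only [ContinuousMap.smul_apply, smul_eq_mul, mul_left_comm _ r, mul_assoc,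
    integral_const_mul] at this
  exact mul_right_cancel₀ hpos.ne' this

/-! ### Spectral gap and its consequences -/

theorem kernelOp_sub_rankOne_apply (k : C(I × I, ℝ)) (ε : ℝ) (φ θ : C(I, ℝ)) (f : C(I, 𝕜))
    (y : I) :
    kernelOp 𝕜 (k - ε • (θ.comp ContinuousMap.fst * φ.comp ContinuousMap.snd)) f y =
      kernelOp 𝕜 k f y - ((ε * φ y : ℝ) : 𝕜) * ∫ x, (θ x : 𝕜) * f x := by
  rw [kernelOp_apply, kernelOp_apply, ← integral_const_mul, ← integral_sub
    (Continuous.integrable_unitInterval (by fun_prop))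
    (Continuous.integrable_unitInterval (by fun_prop))]
  refine integral_congr_ae (ae_of_all _ fun x => ?_)
  simp only [ContinuousMap.sub_apply, ContinuousMap.smul_apply, ContinuousMap.mul_apply,
    ContinuousMap.comp_apply, ContinuousMap.fst_apply, ContinuousMap.snd_apply, smul_eq_mul,
    map_sub, map_mul]
  ring

/-- An eigenfunction whose integral pairing vanishes with the positive eigenfunction `θ` of
the transposed operator belongs to an eigenvalue at a definite distance below the principal one. -/
theorem norm_eigenvalue_le_of_integral_eq_zero {k : C(I × I, ℝ)} {r ε : ℝ} {φ θ : C(I, ℝ)}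
    (hθ : ∀ x, 0 < θ x)
    (h' : kernelOp ℝ (k.comp ContinuousMap.prodSwap) θ = r • θ)
    (hε : ∀ p : I × I, ε * (θ p.1 * φ p.2) ≤ k p) {μ : 𝕜} {ψ : C(I, 𝕜)} (hψ : ψ ≠ 0)
    (hμ : kernelOp 𝕜 k ψ = μ • ψ) (h0 : ∫ x, (θ x : 𝕜) * ψ x = 0) :
    ‖μ‖ ≤ r - ε * ∫ x, θ x * φ x := by
  let k' := k - ε • (θ.comp ContinuousMap.fst * φ.comp ContinuousMap.snd)
  let a : C(I, ℝ) := ⟨fun x => ‖ψ x‖, by fun_prop⟩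
  have ha : 0 < ∫ x, (θ * a) x := by
    obtain ⟨x, hx⟩ := DFunLike.ne_iff.1 hψ
    exact ContinuousMap.integral_pos_of_nonneg_of_ne_zero
      (fun x => mul_nonneg (hθ x).le (norm_nonneg (ψ x)))
      (DFunLike.ne_iff.2 ⟨x, (mul_pos (hθ x) (norm_pos_iff.2 hx)).ne'⟩)
  have hle : ∀ y, ‖μ‖ * a y ≤ kernelOp ℝ k a y - ε * φ y * ∫ x, θ x * a x := by
    intro y
    -- The rank-one term vanishes on `ψ` but not on `a = |ψ|`, where it produces the gain.
    have h1 := norm_kernelOp_apply_le (k := k') (fun p => sub_nonneg.2 (hε p)) ψ y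
    rw [kernelOp_sub_rankOne_apply, h0, mul_zero, sub_zero, hμ, kernelOp_sub_rankOne_apply,
      ContinuousMap.smul_apply, smul_eq_mul,
      norm_mul] at h1
    exact h1
  have hint : ∫ y, θ y * (‖μ‖ * a y) ≤
      ∫ y, (θ y * kernelOp ℝ k a y - θ y * φ y * (ε * ∫ x, θ x * a x)) := by
    refine integral_mono (Continuous.integrable_unitInterval (by fun_prop))
      (Continuous.integrable_unitInterval (by fun_prop)) fun y => ?_
    refine (mul_le_mul_of_nonneg_left (hle y) (hθ y).le).trans_eq ?_
    ring
  rw [integral_sub (Continuous.integrable_unitInterval (by fun_prop))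
    (Continuous.integrable_unitInterval (by fun_prop)), integral_mul_kernelOp, h',
    integral_mul_const] at hint
  simp only [ContinuousMap.smul_apply, smul_eq_mul, mul_left_comm _ ‖μ‖, mul_assoc,
    integral_const_mul] at hint
  refine le_of_mul_le_mul_right ?_ ha
  change ‖μ‖ * ∫ x, θ x * a x ≤ (r - ε * ∫ x, θ x * φ x) * ∫ x, θ x * a x
  linarith

theorem isPrincipalEigenvalue_kernelOp {k : C(I × I, ℝ)} (hk : ∀ p, 0 < k p) {r : ℝ} (hr : 0 < r)
    {φ θ : C(I, ℝ)} (hφ : ∀ x, 0 < φ x) (hθ : ∀ x, 0 < θ x) (h : kernelOp ℝ k φ = r • φ)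
    (h' : kernelOp ℝ (k.comp ContinuousMap.prodSwap) θ = r • θ) :
    IsPrincipalEigenvalue (kernelOp 𝕜 k) r := by
  obtain ⟨m, hm, hmk⟩ := k.exists_pos_forall_le hk
  obtain ⟨ε, hε, hεk⟩ : ∃ ε > 0, ∀ p : I × I, ε * (θ p.1 * φ p.2) ≤ k p := by
    have hθn : 0 < ‖θ‖ := (hθ 0).trans_le ((le_abs_self _).trans (θ.norm_coe_le_norm 0))
    have hφn : 0 < ‖φ‖ := (hφ 0).trans_le ((le_abs_self _).trans (φ.norm_coe_le_norm 0))
    refine ⟨m / (‖θ‖ * ‖φ‖), by positivity, fun p => le_trans ?_ (hmk p)⟩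
    rw [div_mul_eq_mul_div]
    refine div_le_of_le_mul₀ (by positivity) hm.le (mul_le_mul_of_nonneg_left ?_ hm.le)
    exact mul_le_mul ((le_abs_self _).trans (θ.norm_coe_le_norm _))
      ((le_abs_self _).trans (φ.norm_coe_le_norm _)) (hφ _).le (norm_nonneg _)
  have hpos : 0 < ∫ x, θ x * φ x :=
    ContinuousMap.integral_pos_of_nonneg_of_ne_zero (f := θ * φ)
      (fun x => (mul_pos (hθ x) (hφ x)).le)
      (DFunLike.ne_iff.2 ⟨0, (mul_pos (hθ 0) (hφ 0)).ne'⟩)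
  set δ := ε * ∫ x, θ x * φ x with hδ
  have hδ0 : 0 < δ := mul_pos hε hpos
  set T := kernelOp 𝕜 k with hT
  set Φ := φ.ofRealRCLike 𝕜 with hΦ
  have hTΦ : T Φ = (r : 𝕜) • Φ := by
    rw [hT, hΦ, kernelOp_ofRealRCLike, h]
    ext x
    simp [ContinuousMap.ofRealRCLike]
  have hΦ0 : ∀ x, Φ x ≠ 0 := fun x => RCLike.ofReal_ne_zero.2 (hφ x).ne'
  have hΦne : Φ ≠ 0 := DFunLike.ne_iff.2 ⟨0, hΦ0 0⟩
  have hθΦ : ∫ x, (θ x : 𝕜) * Φ x = ((∫ x, θ x * φ x : ℝ) : 𝕜) := by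
    rw [← integral_ofReal]
    simp [hΦ, ContinuousMap.ofRealRCLike]
  have hr𝕜 : (r : 𝕜) ≠ 0 := RCLike.ofReal_ne_zero.2 hr.ne'
  have gap : ∀ {μ : 𝕜} {ψ : C(I, 𝕜)}, ψ ≠ 0 → T ψ = μ • ψ → (∫ x, (θ x : 𝕜) * ψ x = 0) →
      ‖μ‖ ≤ r - δ := fun hψ hμ h0 =>
    norm_eigenvalue_le_of_integral_eq_zero hθ h' hεk hψ hμ h0
  have pairing : ∀ {μ : 𝕜} {ψ : C(I, 𝕜)}, T ψ = μ • ψ → μ ≠ r →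
      ∫ x, (θ x : 𝕜) * ψ x = 0 := by
    intro μ ψ hμ hne
    have := integral_mul_kernelOp k ψ (θ.ofRealRCLike 𝕜)
    rw [← hT, hμ, kernelOp_ofRealRCLike, h'] at this
    simp only [ContinuousMap.ofRealRCLike, ContinuousMap.coe_mk, ContinuousMap.smul_apply,
      smul_eq_mul, map_mul, mul_left_comm _ μ, mul_assoc, integral_const_mul] at this
    exact (mul_eq_mul_right_iff.1 this).resolve_left hne
  have eigenvector_eq : ∀ {ψ : C(I, 𝕜)}, T ψ = (r : 𝕜) • ψ → ∃ c : 𝕜, ψ = c • Φ := by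
    intro ψ hψ
    refine ⟨(∫ x, (θ x : 𝕜) * ψ x) / ∫ x, (θ x : 𝕜) * Φ x, ?_⟩
    set c := (∫ x, (θ x : 𝕜) * ψ x) / ∫ x, (θ x : 𝕜) * Φ x with hc
    by_contra hne
    have h0 : ∫ x, (θ x : 𝕜) * (ψ - c • Φ) x = 0 := by
      simp only [ContinuousMap.sub_apply, ContinuousMap.smul_apply, smul_eq_mul, mul_sub,
        mul_left_comm _ c]
      rw [integral_sub (Continuous.integrable_unitInterval (by fun_prop))
        (Continuous.integrable_unitInterval (by fun_prop)), integral_const_mul, hc,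
        div_mul_cancel₀, sub_self]
      rw [hθΦ]
      exact RCLike.ofReal_ne_zero.2 hpos.ne'
    -- The remainder `ψ - c • Φ` would be an eigenfunction for `r` in the hyperplane, giving `r ≤ r
    -- - δ`.
    have := gap (μ := (r : 𝕜)) (sub_ne_zero.2 hne)
      (by rw [map_sub, map_smul, hψ, hTΦ, smul_sub, smul_comm]) h0
    rw [RCLike.norm_ofReal, abs_of_pos hr] at this
    linarith
  have hΦeig : Module.End.HasEigenvector (T : C(I, 𝕜) →ₗ[𝕜] C(I, 𝕜)) (r : 𝕜) Φ :=
    ⟨Module.End.mem_eigenspace_iff.2 hTΦ, hΦne⟩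
  have hcomp : IsCompactOperator T := isCompactOperator_kernelOp k
  -- The `0` in the maximum covers `μ = 0`, which may be spectral without being an eigenvalue.
  have spec : ∀ μ ∈ spectrum 𝕜 T, μ ≠ (r : 𝕜) → ‖μ‖ ≤ max 0 (r - δ) := by
    intro μ hμ hne
    rcases eq_or_ne μ 0 with rfl | hμ0
    · simp
    obtain ⟨ψ, hψ⟩ := ((hcomp.hasEigenvalue_iff_mem_spectrum hμ0).2 hμ).exists_hasEigenvector
    exact (gap hψ.2 hψ.apply_eq_smul (pairing hψ.apply_eq_smul hne)).trans (le_max_right _ _)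
  have hlt : max 0 (r - δ) < r := max_lt hr (by linarith)
  have hev := Module.End.hasEigenvalue_of_hasEigenvector hΦeig
  refine ⟨⟨hev, fun μ hμ hne => (spec μ hμ hne).trans_lt hlt⟩, ?_, ⟨?_, ?_⟩, φ, hφ, fun ψ => ?_⟩
  · refine finrank_eq_one (R := 𝕜) ⟨Φ, hΦeig.1⟩ (fun h0 => hΦne (congrArg Subtype.val h0)) ?_
    rintro ⟨ψ, hψ⟩
    obtain ⟨c, rfl⟩ := eigenvector_eq (Module.End.mem_eigenspace_iff.1 hψ)
    exact ⟨c, rfl⟩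
  · exact (hcomp.hasEigenvalue_iff_mem_spectrum hr𝕜).1 hev
  · intro hacc
    rw [accPt_iff_nhds] at hacc
    have hU : {z : 𝕜 | max 0 (r - δ) < ‖z‖} ∈ 𝓝 (r : 𝕜) := by
      refine (isOpen_lt continuous_const continuous_norm).mem_nhds ?_
      rwa [Set.mem_ofPred_eq, RCLike.norm_ofReal, abs_of_pos hr]
    obtain ⟨μ, ⟨hμU, hμ⟩, hne⟩ := hacc _ hU
    exact absurd (spec μ hμ hne) (not_le.2 hμU)
  · constructor
    · intro hψ
      obtain ⟨c, rfl⟩ := eigenvector_eq hψ.apply_eq_smul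
      refine ⟨c, ?_, fun x => rfl⟩
      rintro rfl
      exact hψ.2 (zero_smul _ _)
    · rintro ⟨c, hc, hψ⟩
      obtain rfl : ψ = c • Φ := ContinuousMap.ext hψ
      exact ⟨Submodule.smul_mem _ c hΦeig.1, smul_ne_zero hc hΦne⟩

end Kernel

theorem theorem3 (A : C(unitInterval × unitInterval, ℝ)) (β : ℝ) :
    ∃ r : ℝ, 0 < r ∧
      IsPrincipalEigenvalue (perronOp ℝ A β) r ∧
      IsPrincipalEigenvalue (perronOpBar ℝ A β) r ∧
      IsPrincipalEigenvalue (perronOp ℂ A β) r ∧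
      IsPrincipalEigenvalue (perronOpBar ℂ A β) r := by
  have hk : ∀ p, 0 < gibbsKernel A β p := fun p => Real.exp_pos _
  have hk' : ∀ p, 0 < (gibbsKernel A β).comp ContinuousMap.prodSwap p := fun p => Real.exp_pos _
  obtain ⟨r, hr, φ, hφ, hφr⟩ := exists_pos_eigenfunction_kernelOp hk
  obtain ⟨s, -, θ, hθ, hθs⟩ := exists_pos_eigenfunction_kernelOp hk'
  obtain rfl := eigenvalue_eq_of_transpose (k := gibbsKernel A β) hφ hθ hφr hθs
  exact ⟨r, hr, isPrincipalEigenvalue_kernelOp (k := gibbsKernel A β) hk hr hφ hθ hφr hθs,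
    isPrincipalEigenvalue_kernelOp
      (k := (gibbsKernel A β).comp ContinuousMap.prodSwap) hk' hr hθ hφ hθs hφr,
    isPrincipalEigenvalue_kernelOp (k := gibbsKernel A β) hk hr hφ hθ hφr hθs,
    isPrincipalEigenvalue_kernelOp
      (k := (gibbsKernel A β).comp ContinuousMap.prodSwap) hk' hr hθ hφ hθs hφr⟩
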